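/- Consider the following game of cops and robbers on a finite connected simple graph $G$, played by $k$ cops and $m$ robbers with full information. In round $0$ the cops choose their starting vertices, and then the robbers choose theirs. In each of the rounds $1, 2, \ldots$ first every cop and then every remaining robber stays where he or she is or moves to an adjacent vertex. Several players may occupy the same vertex. Whenever a cop and some robbers are on the same vertex, all those robbers are captured and take no further part in the game. The capture time $\mathrm{capt}_k(G,m)$ is the least $t$ such that the cops have a strategy that guarantees that all robbers have been captured by the end of round $t$, whatever the robbers do; write $\mathrm{capt}(G,m)=\mathrm{capt}_1(G,m)$. Let $H(7)$ be the graph on the vertices $1,\ldots,7$ that consists of the path $6,2,1,4$, the two non-adjacent vertices $3$ and $5$, each adjacent to all of $6,2,1,4$, and the vertex $7$, adjacent to $6$, $4$ and $3$ only. For $n\ge 8$ let $H(n)$ be obtained from $H(n-1)$ by adding a vertex $n$ adjacent to $n-1$, $n-3$ and $n-4$. Then for every integer $\ell\ge 2$ and $n=4\ell+2$, $$\mathrm{capt}(H(n),2)=\ell+2(n-4).$$ -/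

import Mathlib

/-! The game of `k` cops and `m` robbers with consecutive capture, its capture time,
and the graphs `H(n)`. -/

namespace CopsRobbers

/-- One move of one player: stay on the same vertex, or go to an adjacent one. -/
def Step {V : Type*} (G : SimpleGraph V) (v w : V) : Prop :=
  v = w ∨ G.Adj v w

/-- A position of the game: where the cops are, and where the robbers are;
`none` stands for a robber who has been captured. -/
@[ext]
structure Position (V : Type*) (k m : ℕ) where
  cops : Fin k → V
  robbers : Fin m → Option V

open Classical in
/-- All the robbers that share a vertex with some cop are captured. -/
noncomputable def capture {V : Type*} {k m : ℕ} (c : Fin k → V) (r : Fin m → Option V) :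
    Fin m → Option V :=
  fun j => if ∃ a, r j = some (c a) then none else r j

/-- A strategy of the cops: starting vertices, and a rule that yields the cops' next move from
the past positions (at the ends of the earlier rounds, in order) and the current position. -/
structure CopStrategy {V : Type*} (G : SimpleGraph V) (k m : ℕ) where
  start : Fin k → V
  move : List (Position V k m) → Position V k m → Fin k → V
  legal : ∀ past now a, Step G (now.cops a) (move past now a)

/-- `q` is a possible position after a round that starts in position `p` and in which the cops
move to `c`: robbers met by the cops are captured, then each remaining robber makes a move, and
the robbers who have moved onto a cop are captured. -/
def IsRound {V : Type*} (G : SimpleGraph V) {k m : ℕ} (p : Position V k m) (c : Fin k → V)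
    (q : Position V k m) : Prop :=
  q.cops = c ∧ ∃ r : Fin m → Option V,
    (∀ j, Option.Rel (Step G) (capture c p.robbers j) (r j)) ∧ q.robbers = capture c r

/-- `p i` (the position at the end of round `i`) is a play in which the cops follow the
strategy `σ`. In round 0 the cops choose their vertices, and then the robbers do. -/
def CopStrategy.IsPlay {V : Type*} {G : SimpleGraph V} {k m : ℕ} (σ : CopStrategy G k m)
    (p : ℕ → Position V k m) : Prop :=
  ((p 0).cops = σ.start ∧
    ∃ r : Fin m → V, (p 0).robbers = capture σ.start (fun j => some (r j))) ∧
  ∀ i, IsRound G (p i) (σ.move ((List.range i).map p) (p i)) (p (i + 1))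

/-- With the strategy `σ` the last robber is captured in round `t` or earlier, whatever the
robbers do. -/
def CopStrategy.WinsBy {V : Type*} {G : SimpleGraph V} {k m : ℕ} (σ : CopStrategy G k m)
    (t : ℕ) : Prop :=
  ∀ p, σ.IsPlay p → ∀ j, (p t).robbers j = none

/-- The capture time `capt_k(G, m)`: the least `t` such that `k` cops have a strategy that
captures all of the `m` robbers by round `t`; it is `⊤` if there is no such `t`. -/
noncomputable def capt {V : Type*} (G : SimpleGraph V) (k m : ℕ) : ℕ∞ :=
  ⨅ (t : ℕ) (_ : ∃ σ : CopStrategy G k m, σ.WinsBy t), (t : ℕ∞)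

/-- The edges of the graphs `H(n)`: those of `H(7)`, and those that join a vertex `a ≥ 8`,
when it is added, to `a - 1`, `a - 3` and `a - 4`. -/
def HEdge (a b : ℕ) : Prop :=
  (a, b) ∈ ([(6, 2), (2, 1), (1, 4), (5, 6), (5, 2), (5, 1), (5, 4), (3, 6), (3, 2), (3, 1),
    (3, 4), (7, 6), (7, 4), (7, 3)] : List (ℕ × ℕ)) ∨
  8 ≤ a ∧ (b = a - 1 ∨ b = a - 3 ∨ b = a - 4)

/-- The graph `H(n)`, for `n ≥ 7`, on the vertices `1, …, n`. -/
def H (n : ℕ) : SimpleGraph (Set.Icc 1 n) :=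
  SimpleGraph.fromRel fun a b => HEdge a b

end CopsRobbers

/-! Apart from the edge between 1 and 3, vertices of `H n` are adjacent exactly when their labels
differ by 1, 3 or 4, so a difference of 2 is what protects a robber. Upper bound: from `c` the cop
descends to 1 or 2, which takes `(c + 1) / 4` rounds. She then climbs, always entering the robber's
residue class modulo 4. He can neither pass her nor get to a difference of 2 modulo 4, and she wins
`n - 4` rounds after the descent (`Catches.step`). Starting on 1, she needs `n - 4` rounds for one
robber and, as `(n + 1) / 4 = ℓ`, at most `n - 4 + ℓ` for the other. Lower bound: a robber copies
the cop's moves at difference 2 until she has descended, and then at difference 5, where she gains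
at most one vertex per round (`Evades.replies`). Two robbers do this together. When they are
cornered on `n` with the cop on `n - 4`, they split to `n - 1` and `n - 3`. Capturing either one
leaves the other at difference 2 from a cop who is again `ℓ` moves away from 1 and 2. -/

namespace CopsRobbers

/-! ### Winning and evading by means of invariants -/

section Game

variable {V : Type*} {G : SimpleGraph V} {k m : ℕ}

/-- If `W t p` is an invariant that the cops can maintain while `t` decreases, and `W 0` says
that no robber is left, then the cops can win in the number of rounds they start with. -/
theorem exists_winsBy {W : ℕ → Position V k m → Prop} {T : ℕ}
    (h0 : ∀ p, W 0 p → ∀ j, p.robbers j = none)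
    (hs : ∀ t p, W (t + 1) p → ∃ c : Fin k → V, (∀ a, Step G (p.cops a) (c a)) ∧
      ∀ q, IsRound G p c q → W t q)
    (start : Fin k → V)
    (hstart : ∀ r : Fin m → V, W T ⟨start, capture start (fun j => some (r j))⟩) :
    ∃ σ : CopStrategy G k m, σ.WinsBy T := by
  classical
  let σ : CopStrategy G k m :=
    { start := start
      move := fun past now =>
        -- The number of rounds left is read off from the length of the history; the form `_ + 1`
        -- matches `hs`.
        if h : W ((T - past.length - 1) + 1) now then (hs _ _ h).choose else now.cops
      legal := by
        intro past now a
        split_ifs with h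
        · exact (hs _ _ h).choose_spec.1 a
        · exact Or.inl rfl }
  refine ⟨σ, fun p hp => ?_⟩
  obtain ⟨⟨hc, r, hr⟩, hround⟩ := hp
  have key : ∀ i ≤ T, W (T - i) (p i) := by
    intro i
    induction i with
    | zero =>
      intro _
      have : p 0 = ⟨start, capture start (fun j => some (r j))⟩ := Position.ext hc hr
      rw [this]
      exact hstart r
    | succ i ih =>
      intro hi
      have h1 := ih (by omega)
      have h2 : W ((T - ((List.range i).map p).length - 1) + 1) (p i) := by
        rw [List.length_map, List.length_range]
        rwa [show T - i - 1 + 1 = T - i by omega]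
      have h3 := hround i
      have hmove : σ.move ((List.range i).map p) (p i) = (hs _ _ h2).choose := dif_pos h2
      rw [hmove] at h3
      have h4 := (hs _ _ h2).choose_spec.2 _ h3
      rw [List.length_map, List.length_range] at h4
      rwa [show T - (i + 1) = T - i - 1 by omega]
  exact h0 _ (by simpa using key T le_rfl)

/-- If `I t p` is an invariant that the robbers can maintain while `t` decreases to `0`, and it
implies that some robber is left as long as `t` is positive, then the cops cannot win earlier. -/
theorem not_winsBy {I : ℕ → Position V k m → Prop} {T : ℕ}
    (h0 : ∀ t p, I (t + 1) p → ∃ j, p.robbers j ≠ none)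
    (hs : ∀ t p (c : Fin k → V), I (t + 1) p → (∀ a, Step G (p.cops a) (c a)) →
      ∃ q, IsRound G p c q ∧ I t q)
    (hz : ∀ p, I 0 p)
    (hstart : ∀ start : Fin k → V, ∃ r : Fin m → V,
      I T ⟨start, capture start (fun j => some (r j))⟩)
    (σ : CopStrategy G k m) {t : ℕ} (ht : t < T) : ¬ σ.WinsBy t := by
  classical
  intro hwin
  -- A play never ends, so the robbers' rule is extended past time 0, where `0 - 1 = 0` and they
  -- stand still.
  have hs' : ∀ t p (c : Fin k → V), I t p → (∀ a, Step G (p.cops a) (c a)) →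
      ∃ q, IsRound G p c q ∧ I (t - 1) q := by
    rintro (_ | t) p c h hc
    · exact ⟨⟨c, capture c (capture c p.robbers)⟩, ⟨rfl, capture c p.robbers, fun j => by
        cases capture c p.robbers j
        · exact Option.Rel.none
        · exact Option.Rel.some (Or.inl rfl), rfl⟩, hz _⟩
    · exact hs t p c h hc
  choose! next hnext using hs'
  obtain ⟨r, hr⟩ := hstart σ.start
  let hist : ℕ → List (Position V k m) × Position V k m := fun i =>
    Nat.rec ([], ⟨σ.start, capture σ.start (fun j => some (r j))⟩)
      (fun i x => (x.1 ++ [x.2], next (T - i) x.2 (σ.move x.1 x.2))) i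
  let p : ℕ → Position V k m := fun i => (hist i).2
  have hpast : ∀ i, (hist i).1 = (List.range i).map p := by
    intro i
    induction i with
    | zero => rfl
    | succ i ih =>
      rw [List.range_succ, List.map_append, ← ih]
      rfl
  have hsucc : ∀ i, p (i + 1) = next (T - i) (p i) (σ.move ((List.range i).map p) (p i)) := by
    intro i
    rw [← hpast i]
  have hI : ∀ i, I (T - i) (p i) := by
    intro i
    induction i with
    | zero => exact hr
    | succ i ih =>
      rw [hsucc]
      exact (hnext _ _ _ ih (fun a => σ.legal _ _ a)).2
  have hplay : σ.IsPlay p := by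
    refine ⟨⟨rfl, r, rfl⟩, fun i => ?_⟩
    rw [hsucc]
    exact (hnext _ _ _ (hI i) (fun a => σ.legal _ _ a)).1
  have h1 := hI t
  rw [show T - t = (T - t - 1) + 1 by omega] at h1
  obtain ⟨j, hj⟩ := h0 _ _ h1
  exact hj (hwin p hplay j)

theorem capt_eq {T : ℕ} (h : ∃ σ : CopStrategy G k m, σ.WinsBy T)
    (h' : ∀ t < T, ∀ σ : CopStrategy G k m, ¬ σ.WinsBy t) : capt G k m = T := by
  refine le_antisymm (iInf₂_le T h) (le_iInf₂ fun t ⟨σ, hσ⟩ => ?_)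
  by_contra hlt
  exact h' t (by exact_mod_cast not_le.1 hlt) σ hσ

theorem capture_eq_some {c : Fin 1 → V} {r : Fin m → Option V} {j : Fin m} {v : V} :
    capture c r j = some v ↔ r j = some v ∧ v ≠ c 0 := by
  classical
  have : (∃ a, r j = some (c a)) ↔ r j = some (c 0) :=
    ⟨fun ⟨a, ha⟩ => by rwa [Subsingleton.elim a 0] at ha, fun h => ⟨0, h⟩⟩
  simp only [capture, this]
  split_ifs with h
  · simp only [h, Option.some.injEq, false_iff, not_and, not_not]
    exact fun h => h.symm
  · constructor
    · rintro h'
      refine ⟨h', ?_⟩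
      rintro rfl
      exact h h'
    · exact fun h => h.1

theorem IsRound.exists_of_eq_some {p q : Position V 1 m} {c : Fin 1 → V} (h : IsRound G p c q)
    {j : Fin m} {w : V} (hw : q.robbers j = some w) :
    ∃ v, p.robbers j = some v ∧ v ≠ c 0 ∧ w ≠ c 0 ∧ Step G v w := by
  obtain ⟨-, r, hr, hq⟩ := h
  rw [hq, capture_eq_some] at hw
  have h1 := hr j
  rw [hw.1] at h1
  cases hv : capture c p.robbers j with
  | none => rw [hv] at h1; cases h1
  | some v =>
    rw [hv] at h1
    rw [capture_eq_some] at hv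
    cases h1 with
    | some h1 => exact ⟨v, hv.1, hv.2, hw.2, h1⟩

/-- The robbers may choose their moves `x` freely. -/
theorem exists_isRound (p : Position V 1 m) (c : Fin 1 → V) (x : Fin m → V)
    (hx : ∀ j v, p.robbers j = some v → v ≠ c 0 → Step G v (x j)) :
    ∃ q, IsRound G p c q ∧ q.cops = c ∧
      ∀ j v, p.robbers j = some v → v ≠ c 0 → x j ≠ c 0 → q.robbers j = some (x j) := by
  refine ⟨⟨c, capture c fun j => (capture c p.robbers j).map fun _ => x j⟩,
    ⟨rfl, _, fun j => ?_, rfl⟩, rfl, fun j v hv hvc hxc => ?_⟩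
  · cases hv : capture c p.robbers j with
    | none => exact Option.Rel.none
    | some v =>
      rw [capture_eq_some] at hv
      exact Option.Rel.some (hx j v hv.1 hv.2)
  · have : capture c p.robbers j = some v := capture_eq_some.2 ⟨hv, hvc⟩
    simp only [capture_eq_some, this, Option.map_some, true_and]
    exact hxc

end Game

/-! ### Adjacency in `H n` through differences of labels -/

/-- Two vertices of `H n` are equal or adjacent; see `step_H_iff`. -/
def Near (a b : ℕ) : Prop :=
  a = b ∨ a + 1 = b ∨ b + 1 = a ∨ a + 3 = b ∨ b + 3 = a ∨ a + 4 = b ∨ b + 4 = a ∨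
    (a = 1 ∧ b = 3) ∨ (a = 3 ∧ b = 1)

theorem near_iff_hedge {a b : ℕ} (ha : 1 ≤ a) (hb : 1 ≤ b) :
    Near a b ↔ a = b ∨ HEdge a b ∨ HEdge b a := by
  unfold Near HEdge
  by_cases h : a < 8 ∧ b < 8
  · have key : ∀ a b : Fin 8, 1 ≤ (a : ℕ) → 1 ≤ (b : ℕ) →
        (Near a b ↔ (a : ℕ) = b ∨ HEdge a b ∨ HEdge b a) := by
      unfold Near HEdge
      decide
    exact key ⟨a, h.1⟩ ⟨b, h.2⟩ ha hb
  · have not_mem : ∀ {x y : ℕ}, 8 ≤ x ∨ 8 ≤ y →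
        (x, y) ∉ ([(6, 2), (2, 1), (1, 4), (5, 6), (5, 2), (5, 1), (5, 4), (3, 6), (3, 2), (3, 1),
          (3, 4), (7, 6), (7, 4), (7, 3)] : List (ℕ × ℕ)) := by
      intro x y hxy
      simp only [List.mem_cons, Prod.mk.injEq, List.not_mem_nil, or_false]
      omega
    simp only [not_mem (show 8 ≤ a ∨ 8 ≤ b by omega), not_mem (show 8 ≤ b ∨ 8 ≤ a by omega),
      false_or]
    omega

theorem step_H_iff {n : ℕ} (a b : Set.Icc 1 n) : Step (H n) a b ↔ Near a b := by
  rw [near_iff_hedge a.2.1 b.2.1, Step, H, SimpleGraph.fromRel_adj, ← Subtype.ext_iff]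
  tauto

/-! ### Upper bound: one cop against one robber, then against two -/

/-- A sufficient condition for the cop on `c`, who is about to move, to capture the robber on `r`
within `t` rounds; see `Catches.step`. -/
def Catches (n t c r : ℕ) : Prop :=
  n - 4 + (c + 1) / 4 ≤ t ∨ (c = 1 ∧ r % 4 ≠ 2 ∧ n - 5 ≤ t) ∨
    (c < r ∧ (r - c) % 4 ≠ 2 ∧ n ≤ t + c + 3 ∧ 1 ≤ t)

/-- The three alternatives of `Catches` are the descent to 1 or 2, the cop on 1 with one round saved
because she need not pass through 2, and the climb, which gains at least one vertex per round. -/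
theorem Catches.step {n t c r : ℕ} (hn : 10 ≤ n) (hc : 1 ≤ c ∧ c ≤ n) (hr : 1 ≤ r ∧ r ≤ n)
    (hcr : r ≠ c) (h : Catches n (t + 1) c r) :
    ∃ d, (1 ≤ d ∧ d ≤ n) ∧ Near c d ∧ (r ≠ d → ∀ r', 1 ≤ r' ∧ r' ≤ n → Near r r' → r' ≠ d →
      Catches n t d r') := by
  -- If the robber is not caught on `d`, he is at least 4 above it in the same class. His move
  -- changes his label by 0, 1, 3 or 4, so he stays above `d` and off the difference 2 modulo 4.
  have up (h : ∃ d, d ≤ r ∧ d % 4 = r % 4 ∧ c < d ∧ Near c d ∧ (r ≠ d → n ≤ t + d + 3)) :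
      ∃ d, (1 ≤ d ∧ d ≤ n) ∧ Near c d ∧ (r ≠ d → ∀ r', 1 ≤ r' ∧ r' ≤ n → Near r r' → r' ≠ d →
        Catches n t d r') := by
    obtain ⟨d, h1, h2, h3, h4, h5⟩ := h
    refine ⟨d, by omega, h4, fun hrd r' hr' hrr' hne => Or.inr (Or.inr ?_)⟩
    have h5 := h5 hrd
    unfold Near at hrr'
    omega
  have from_one (h1 : c = 1) (h2 : r % 4 = 2 → n - 4 ≤ t + 1) (h3 : n - 5 ≤ t + 1) := by
    refine up ?_
    have : r % 4 = 0 ∨ r % 4 = 1 ∨ r % 4 = 2 ∨ r % 4 = 3 := by omega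
    rcases this with h | h | h | h
    · exact ⟨4, by unfold Near; omega⟩
    · exact ⟨5, by unfold Near; omega⟩
    · exact ⟨2, by unfold Near; omega⟩
    · exact ⟨3, by unfold Near; omega⟩
  rcases h with h | ⟨h1, h2, h3⟩ | ⟨h1, h2, h3, h4⟩
  · have : c = 1 ∨ c = 2 ∨ c = 3 ∨ c = 4 ∨ c = 5 ∨ c = 6 ∨ 7 ≤ c := by omega
    rcases this with rfl | rfl | rfl | rfl | rfl | rfl | hc7
    · exact from_one rfl (by omega) (by omega)
    -- No neighbour of 2 is a multiple of 4. The cop steps back to 1, and a robber coming from a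
    -- multiple of 4 cannot then be in class 2, so the saved round pays for the detour.
    · by_cases h1 : r = 1 ∨ r % 4 = 0
      · refine ⟨1, by omega, by unfold Near; omega, fun hr1 r' hr' hrr' hne => Or.inr (Or.inl ?_)⟩
        unfold Near at hrr'
        omega
      · refine up ?_
        have : r % 4 = 1 ∨ r % 4 = 2 ∨ r % 4 = 3 := by omega
        rcases this with h | h | h
        · exact ⟨5, by unfold Near; omega⟩
        · exact ⟨6, by unfold Near; omega⟩
        · exact ⟨3, by unfold Near; omega⟩
    · exact ⟨1, by omega, by unfold Near; omega, fun _ _ _ _ _ => Or.inl (by omega)⟩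
    · exact ⟨1, by omega, by unfold Near; omega, fun _ _ _ _ _ => Or.inl (by omega)⟩
    · exact ⟨1, by omega, by unfold Near; omega, fun _ _ _ _ _ => Or.inl (by omega)⟩
    · exact ⟨2, by omega, by unfold Near; omega, fun _ _ _ _ _ => Or.inl (by omega)⟩
    · exact ⟨c - 4, by omega, by unfold Near; omega, fun _ _ _ _ _ => Or.inl (by omega)⟩
  · exact from_one h1 (by omega) (by omega)
  · refine up ?_
    have : (r - c) % 4 = 0 ∨ (r - c) % 4 = 1 ∨ (r - c) % 4 = 3 := by omega
    rcases this with h | h | h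
    · exact ⟨c + 4, by unfold Near; omega⟩
    · exact ⟨c + 1, by unfold Near; omega⟩
    · exact ⟨c + 3, by unfold Near; omega⟩

/-- The cop starts on the vertex `1` and chases one robber at a time. -/
theorem exists_winsBy_H {n ℓ : ℕ} (hℓ : 2 ≤ ℓ) (hn : n = 4 * ℓ + 2) :
    ∃ σ : CopStrategy (H n) 1 2, σ.WinsBy (ℓ + 2 * (n - 4)) := by
  -- Robber 0 is chased first; `n - 4 + ℓ` rounds are held in reserve for the other, wherever the
  -- first chase ends.
  let W : ℕ → Position (Set.Icc 1 n) 1 2 → Prop := fun t p =>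
    (∃ i j, i ≠ j ∧ p.robbers i = none ∧
      ∀ v, p.robbers j = some v → v ≠ p.cops 0 ∧ Catches n t (p.cops 0) v) ∨
    ∃ s v, p.robbers 0 = some v ∧ v ≠ p.cops 0 ∧ Catches n s (p.cops 0) v ∧ s + (n - 4 + ℓ) ≤ t
  have pos : ∀ {c r}, ¬ Catches n 0 c r := by
    unfold Catches
    omega
  have step : ∀ {t} {c r : Set.Icc 1 n}, r ≠ c → Catches n (t + 1) c r →
      ∃ d, Step (H n) c d ∧ (r ≠ d → ∀ r', Step (H n) r r' → r' ≠ d → Catches n t d r') := by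
    intro t c r hcr h
    obtain ⟨d, hd, hcd, h'⟩ := h.step (by omega) c.2 r.2 (by simpa [Subtype.ext_iff] using hcr)
    refine ⟨⟨d, hd⟩, (step_H_iff _ _).2 hcd, fun hrd r' hrr' hne => ?_⟩
    exact h' (by simpa [Subtype.ext_iff] using hrd) r' r'.2 ((step_H_iff _ _).1 hrr')
      (by simpa [Subtype.ext_iff] using hne)
  refine exists_winsBy (W := W) ?_ ?_ (fun _ => ⟨1, by simp; omega⟩) ?_
  · rintro p (⟨i, j, hij, hi, hj⟩ | ⟨s, v, -, -, -, h⟩) a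
    · by_cases hai : a = i
      · rw [hai, hi]
      · obtain rfl : a = j := by omega
        by_contra hne
        obtain ⟨v, hv⟩ := Option.ne_none_iff_exists'.1 hne
        exact pos (hj v hv).2
    · omega
  · rintro t p (⟨i, j, hij, hi, hj⟩ | ⟨s, v, hv, hvc, hs, h⟩)
    · cases hv : p.robbers j with
      | none =>
        refine ⟨p.cops, fun _ => Or.inl rfl, fun q hq => Or.inl ⟨i, j, hij, ?_, fun w hw => ?_⟩⟩
        · by_contra hne
          obtain ⟨w, hw⟩ := Option.ne_none_iff_exists'.1 hne
          obtain ⟨v, hv, -⟩ := hq.exists_of_eq_some hw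
          simp [hi] at hv
        · obtain ⟨v, hv', -⟩ := hq.exists_of_eq_some hw
          simp [hv] at hv'
      | some v =>
        obtain ⟨d, hcd, hd⟩ := step (hj v hv).1 (hj v hv).2
        refine ⟨fun _ => d, fun a => by rwa [Subsingleton.elim a 0],
          fun q hq => Or.inl ⟨i, j, hij, ?_, fun w hw => ?_⟩⟩
        · by_contra hne
          obtain ⟨w, hw⟩ := Option.ne_none_iff_exists'.1 hne
          obtain ⟨v, hv, -⟩ := hq.exists_of_eq_some hw
          simp [hi] at hv
        · obtain ⟨v', hv', h1, h2, h3⟩ := hq.exists_of_eq_some hw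
          obtain rfl : v = v' := by simpa [hv] using hv'
          rw [hq.1]
          exact ⟨h2, hd h1 w h3 h2⟩
    · obtain _ | s := s
      · exact absurd hs pos
      obtain ⟨d, hcd, hd⟩ := step hvc hs
      refine ⟨fun _ => d, fun a => by rwa [Subsingleton.elim a 0], fun q hq => ?_⟩
      cases hw : q.robbers 0 with
      | none =>
        refine Or.inl ⟨0, 1, by simp, hw, fun w hw => ?_⟩
        obtain ⟨-, -, -, h2, -⟩ := hq.exists_of_eq_some hw
        rw [hq.1]
        have := d.2.2
        exact ⟨h2, Or.inl (by dsimp only; omega)⟩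
      | some w =>
        obtain ⟨v', hv', h1, h2, h3⟩ := hq.exists_of_eq_some hw
        obtain rfl : v = v' := by simpa [hv] using hv'
        refine Or.inr ⟨s, w, hw, ?_⟩
        rw [hq.1]
        exact ⟨h2, hd h1 w h3 h2, by omega⟩
  · intro r
    cases hw : capture (fun _ : Fin 1 => (⟨1, by simp; omega⟩ : Set.Icc 1 n))
        (fun j => some (r j)) 0 with
    | none =>
      refine Or.inl ⟨0, 1, by simp, hw, fun w hw => ?_⟩
      dsimp only at hw
      exact ⟨(capture_eq_some.1 hw).2, Or.inl (by simp; omega)⟩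
    | some w =>
      exact Or.inr ⟨n - 4, w, hw, (capture_eq_some.1 hw).2, Or.inl (by simp), by omega⟩

/-! ### Lower bound: evasion by one robber, then by two -/

/-- A sufficient condition for the robber on `r` to evade the cop on `c`, who is about to move,
so that he is still free after `t - 1` rounds. -/
def Evades (n t c r : ℕ) : Prop :=
  (3 ≤ c ∧ c + 2 ≤ n ∧ r = c + 2 ∧ t ≤ n - 4 + (c + 1) / 4) ∨
  (c ≤ n ∧ n ≤ c + 1 ∧ r + 2 = c ∧ t ≤ n - 4 + (c + 1) / 4) ∨
  (r = c + 5 ∧ r ≤ n ∧ t + c + 3 ≤ n) ∨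
  (c = 2 ∧ r = 8 ∧ t + 4 ≤ n) ∨ (c = 1 ∧ r = 7 ∧ t + 5 ≤ n) ∨ (r = c + 6 ∧ r ≤ n ∧ t ≤ 2)

/-- The cop has moved to `d`, and the robber on `r` has a reply that evades her. -/
def Replies (n t d r : ℕ) : Prop :=
  r ≠ d ∧ ∃ r', (1 ≤ r' ∧ r' ≤ n) ∧ Near r r' ∧ Evades n t d r'

section Replies

variable {n t d r : ℕ}

theorem Replies.ahead (h1 : r ≠ d) (h2 : Near r (d + 2))
    (h3 : 3 ≤ d ∧ d + 2 ≤ n ∧ t ≤ n - 4 + (d + 1) / 4) : Replies n t d r :=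
  ⟨h1, d + 2, by omega, h2, Or.inl (by omega)⟩

theorem Replies.behind (h1 : r ≠ d) (h2 : Near r (d - 2))
    (h3 : 3 ≤ d ∧ d ≤ n ∧ n ≤ d + 1 ∧ t ≤ n - 4 + (d + 1) / 4) : Replies n t d r :=
  ⟨h1, d - 2, by omega, h2, Or.inr (Or.inl (by omega))⟩

theorem Replies.far (h1 : r ≠ d) (h2 : Near r (d + 5)) (h3 : d + 5 ≤ n ∧ t + d + 3 ≤ n) :
    Replies n t d r :=
  ⟨h1, d + 5, by omega, h2, Or.inr (Or.inr (Or.inl (by omega)))⟩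

theorem Replies.of_eq_two (h1 : r ≠ d) (h2 : Near r 8) (h3 : d = 2 ∧ 8 ≤ n ∧ t + 4 ≤ n) :
    Replies n t d r :=
  ⟨h1, 8, by omega, h2, Or.inr (Or.inr (Or.inr (Or.inl (by omega))))⟩

theorem Replies.of_eq_one (h1 : r ≠ d) (h2 : Near r 7) (h3 : d = 1 ∧ 7 ≤ n ∧ t + 5 ≤ n) :
    Replies n t d r :=
  ⟨h1, 7, by omega, h2, Or.inr (Or.inr (Or.inr (Or.inr (Or.inl (by omega)))))⟩

theorem Replies.farther (h1 : r ≠ d) (h2 : Near r (d + 6)) (h3 : d + 6 ≤ n ∧ t ≤ 2) :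
    Replies n t d r :=
  ⟨h1, d + 6, by omega, h2, Or.inr (Or.inr (Or.inr (Or.inr (Or.inr (by omega)))))⟩

/-- At difference 2 the bound on `t` survives because `(c + 1) / 4` changes by at most 1 per move.
At difference 5 a cop who climbs by more than 1 lets the robber return to difference 2. The excluded
case is the corner: the robber on `n` cannot keep difference 5. -/
theorem Evades.replies {c : ℕ} (hn : 10 ≤ n) (hc : 1 ≤ c) (hd : 1 ≤ d ∧ d ≤ n)
    (ht : 1 ≤ t) (h : Evades n (t + 1) c r) (hcd : Near c d)
    (hne : ¬ (c + 5 = n ∧ r = n ∧ d = c + 1)) : Replies n t d r := by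
  unfold Evades at h
  unfold Near at hcd
  rcases h with h | h | h | h | h | h
  · by_cases h1 : d = 1
    · exact .far (by omega) (by unfold Near; omega) (by omega)
    by_cases h2 : d = 2
    · exact .of_eq_two (by omega) (by unfold Near; omega) (by omega)
    by_cases hdn : d + 2 ≤ n
    · exact .ahead (by omega) (by unfold Near; omega) (by omega)
    · exact .behind (by omega) (by unfold Near; omega) (by omega)
  · by_cases hdn : d + 2 ≤ n
    · exact .ahead (by omega) (by unfold Near; omega) (by omega)
    · exact .behind (by omega) (by unfold Near; omega) (by omega)
  · by_cases h1 : d ≤ c + 1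
    -- The exceptional edge takes the cop from 3 to 1, and the robber on 8 cannot reach 6; he goes
    -- to 7 instead.
    · by_cases h2 : c = 3 ∧ d = 1
      · exact .of_eq_one (by omega) (by unfold Near; omega) (by omega)
      · exact .far (by omega) (by unfold Near; omega) (by omega)
    · by_cases hdn : d + 2 ≤ n
      · exact .ahead (by omega) (by unfold Near; omega) (by omega)
      · exact .behind (by omega) (by unfold Near; omega) (by omega)
  · by_cases h1 : d = 1
    · exact .of_eq_one (by omega) (by unfold Near; omega) (by omega)
    by_cases h2 : d = 2
    · exact .of_eq_two (by omega) (by unfold Near; omega) (by omega)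
    · exact .ahead (by omega) (by unfold Near; omega) (by omega)
  · by_cases h1 : d = 1
    · exact .of_eq_one (by omega) (by unfold Near; omega) (by omega)
    by_cases h2 : d ≤ 3
    · exact .far (by omega) (by unfold Near; omega) (by omega)
    · exact .ahead (by omega) (by unfold Near; omega) (by omega)
  · by_cases h1 : c + 3 ≤ d
    · exact .ahead (by omega) (by unfold Near; omega) (by omega)
    by_cases h2 : d + 1 = c ∨ d + 4 = c
    · exact .farther (by omega) (by unfold Near; omega) (by omega)
    · exact .far (by omega) (by unfold Near; omega) (by omega)

end Replies

/-- The robbers stay together until they are about to be captured near the vertex `n`; then they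
split, and the one who is left escapes to start over. -/
theorem not_winsBy_H {n ℓ t : ℕ} (hℓ : 2 ≤ ℓ) (hn : n = 4 * ℓ + 2) (ht : t < ℓ + 2 * (n - 4))
    (σ : CopStrategy (H n) 1 2) : ¬ σ.WinsBy t := by
  let alone : ℕ → Position (Set.Icc 1 n) 1 2 → Prop := fun t p =>
    ∃ j r, p.robbers j = some r ∧ r ≠ p.cops 0 ∧ (t ≤ 1 ∨ Evades n t (p.cops 0) r)
  let together : ℕ → Position (Set.Icc 1 n) 1 2 → Prop := fun t p =>
    ∃ r s, (∀ j, p.robbers j = some r) ∧ 2 ≤ s ∧ Evades n s (p.cops 0) r ∧ t ≤ n - 4 + ℓ + s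
  let split : ℕ → Position (Set.Icc 1 n) 1 2 → Prop := fun t p =>
    ∃ x : Fin 2 → Set.Icc 1 n, (∀ j, p.robbers j = some (x j)) ∧ (x 0 : ℕ) + 1 = n ∧
      (x 1 : ℕ) + 3 = n ∧ (p.cops 0 : ℕ) + 4 = n ∧ t ≤ n - 4 + ℓ + 1
  have ne : ∀ {a b : Set.Icc 1 n}, a ≠ b ↔ (a : ℕ) ≠ b := by
    simp [Subtype.ext_iff]
  have evades_ne : ∀ {t c r}, Evades n t c r → r ≠ c := by
    unfold Evades
    omega
  have move_one : ∀ {t p} {c : Fin 1 → Set.Icc 1 n} {j r} (r' : Set.Icc 1 n),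
      p.robbers j = some r → r ≠ c 0 → Near r r' → r' ≠ c 0 →
      (t ≤ 1 ∨ Evades n t (c 0) r') → ∃ q, IsRound (H n) p c q ∧ alone t q := by
    intro t p c j r r' hr hrc hrr' hrc' he
    obtain ⟨q, hq, hqc, hqr⟩ := exists_isRound (G := H n) p c
      -- The other robber, if still free, stays put; the default `r'` is never used for a free
      -- robber.
      (Function.update (fun i => (p.robbers i).getD r') j r') (fun i v hv _ => by
        by_cases hij : i = j
        · subst hij
          obtain rfl : r = v := by simpa [hr] using hv
          simpa using (step_H_iff _ _).2 hrr'
        · rw [Function.update_of_ne hij, hv]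
          exact Or.inl rfl)
    refine ⟨q, hq, j, r', ?_, ?_, ?_⟩
    · simpa [hrc'] using hqr j r hr hrc
    · rwa [hqc]
    · rwa [hqc]
  have move_both : ∀ {p : Position (Set.Icc 1 n) 1 2} {c : Fin 1 → Set.Icc 1 n}
      {x y : Fin 2 → Set.Icc 1 n}, (∀ j, p.robbers j = some (x j)) → (∀ j, x j ≠ c 0) →
      (∀ j, Near (x j) (y j)) → (∀ j, y j ≠ c 0) →
      ∃ q, IsRound (H n) p c q ∧ q.cops = c ∧ ∀ j, q.robbers j = some (y j) := by
    intro p c x y hx hxc hxy hyc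
    obtain ⟨q, hq, hqc, hqr⟩ := exists_isRound (G := H n) p c y (fun i v hv _ => by
      obtain rfl : x i = v := by simpa [hx] using hv
      exact (step_H_iff _ _).2 (hxy i))
    exact ⟨q, hq, hqc, fun j => hqr j _ (hx j) (hxc j) (hyc j)⟩
  refine not_winsBy (I := fun t p => t = 0 ∨ alone t p ∨ together t p ∨ split t p)
    ?_ ?_ (fun p => Or.inl rfl) ?_ σ ht
  · rintro t p (h | ⟨j, r, h, -⟩ | ⟨r, s, h, -⟩ | ⟨x, h, -⟩)
    · omega
    · exact ⟨j, by simp [h]⟩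
    · exact ⟨0, by simp [h]⟩
    · exact ⟨0, by simp [h]⟩
  · intro t p c h hc
    replace hc := (step_H_iff _ _).1 (hc 0)
    by_cases ht0 : t = 0
    · obtain ⟨q, hq, -⟩ := exists_isRound (G := H n) p c (fun i => (p.robbers i).getD (c 0))
        (fun i v hv _ => by rw [hv]; exact Or.inl rfl)
      exact ⟨q, hq, Or.inl ht0⟩
    have hp := (p.cops 0).2
    have hd := (c 0).2
    rcases h with h | ⟨j, r, hr, hrc, h⟩ | ⟨r, s, hr, hs, h, hts⟩ | ⟨x, hx, hx0, hx1, hpc, htt⟩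
    · omega
    · replace h : Evades n (t + 1) (p.cops 0) r := h.resolve_left (by omega)
      by_cases hex : (p.cops 0 : ℕ) + 5 = n ∧ (r : ℕ) = n ∧ (c 0 : ℕ) = (p.cops 0 : ℕ) + 1
      · have h1 : r ≠ c 0 := ne.2 (by omega)
        -- A cornered lone robber has at most one round left to survive, so standing still is
        -- enough.
        obtain ⟨q, hq, h2⟩ := move_one (t := t) r hr h1 (Or.inl rfl) h1
          (Or.inl (by unfold Evades at h; omega))
        exact ⟨q, hq, Or.inr (Or.inl h2)⟩
      · obtain ⟨h1, r', hr', h2, h3⟩ := h.replies (by omega) hp.1 hd (by omega) hc hex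
        obtain ⟨q, hq, h4⟩ := move_one (t := t) ⟨r', hr'⟩ hr (ne.2 h1) h2
          (ne.2 (evades_ne h3)) (Or.inr h3)
        exact ⟨q, hq, Or.inr (Or.inl h4)⟩
    · obtain ⟨s, rfl⟩ : ∃ u, s = u + 1 := ⟨s - 1, by omega⟩
      by_cases hex : (p.cops 0 : ℕ) + 5 = n ∧ (r : ℕ) = n ∧ (c 0 : ℕ) = (p.cops 0 : ℕ) + 1
      · have hs2 : s ≤ 1 := by unfold Evades at h; omega
        let y : Fin 2 → Set.Icc 1 n :=
          ![⟨n - 1, by simp only [Set.mem_Icc]; omega⟩, ⟨n - 3, by simp only [Set.mem_Icc]; omega⟩]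
        have hy0 : (y 0 : ℕ) = n - 1 := rfl
        have hy1 : (y 1 : ℕ) = n - 3 := rfl
        obtain ⟨q, hq, hqc, hqr⟩ := move_both (c := c) (x := fun _ => r) (y := y) hr
          (fun _ => ne.2 (by omega))
          (Fin.forall_fin_two.2 ⟨by unfold Near; omega, by unfold Near; omega⟩)
          (Fin.forall_fin_two.2 ⟨ne.2 (by omega), ne.2 (by omega)⟩)
        refine ⟨q, hq, Or.inr (Or.inr (Or.inr ⟨y, hqr, by omega, by omega, ?_, by omega⟩))⟩
        rw [hqc]
        omega
      · obtain ⟨h1, r', hr', h2, h3⟩ := h.replies (by omega) hp.1 hd (by omega) hc hex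
        obtain ⟨q, hq, hqc, hqr⟩ := move_both (c := c) (x := fun _ => r) (y := fun _ => ⟨r', hr'⟩)
          hr (fun _ => ne.2 h1) (fun _ => h2) (fun _ => ne.2 (evades_ne h3))
        -- Outside the corner, evading for 1 gives evading for 2, so the pair's clock never falls
        -- below 2.
        refine ⟨q, hq, Or.inr (Or.inr (Or.inl ⟨⟨r', hr'⟩, max s 2, hqr, by omega, ?_, by omega⟩))⟩
        rw [hqc]
        by_cases hs1 : s = 1
        · subst hs1
          unfold Evades at h3 ⊢
          simp only [show max 1 2 = 2 by rfl]
          omega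
        · rwa [max_eq_left (by omega)]
    · have both (y : Set.Icc 1 n) (h1 : ∀ j, x j ≠ c 0) (h2 : ∀ j, Near (x j) y)
          (h3 : Evades n 2 (c 0) y) : ∃ q, IsRound (H n) p c q ∧
          (t = 0 ∨ alone t q ∨ together t q ∨ split t q) := by
        obtain ⟨q, hq, hqc, hqr⟩ := move_both (y := fun _ => y) hx h1 h2
          (fun _ => ne.2 (evades_ne h3))
        refine ⟨q, hq, Or.inr (Or.inr (Or.inl ⟨y, 2, hqr, le_rfl, ?_, by omega⟩))⟩
        rwa [hqc]
      have single (j : Fin 2) (y : Set.Icc 1 n) (h1 : x j ≠ c 0) (h2 : Near (x j) y)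
          (h3 : Evades n t (c 0) y) : ∃ q, IsRound (H n) p c q ∧
          (t = 0 ∨ alone t q ∨ together t q ∨ split t q) := by
        obtain ⟨q, hq, h4⟩ := move_one y (hx j) h1 h2 (ne.2 (evades_ne h3)) (Or.inr h3)
        exact ⟨q, hq, Or.inr (Or.inl h4)⟩
      have hcases : (c 0 : ℕ) + 4 = n ∨ (c 0 : ℕ) + 3 = n ∨ (c 0 : ℕ) + 1 = n ∨ (c 0 : ℕ) = n ∨
          (c 0 : ℕ) + 5 = n ∨ (c 0 : ℕ) + 7 = n ∨ (c 0 : ℕ) + 8 = n := by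
        unfold Near at hc
        omega
      rcases hcases with h | h | h | h | h | h | h
      · have hxc : ∀ j, x j ≠ c 0 := Fin.forall_fin_two.2 ⟨ne.2 (by omega), ne.2 (by omega)⟩
        obtain ⟨q, hq, hqc, hqr⟩ := move_both hx hxc (fun _ => Or.inl rfl) hxc
        refine ⟨q, hq, Or.inr (Or.inr (Or.inr ⟨x, hqr, hx0, hx1, ?_, by omega⟩))⟩
        rwa [hqc]
      -- One robber is captured here or in the next case. Since `n = 4 * ℓ + 2`, both `(n - 3 + 1) /
      -- 4` and `(n - 1 + 1) / 4` equal `ℓ`, which is exactly the time the survivor needs.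
      · exact single 0 (x 0) (ne.2 (by omega)) (Or.inl rfl) (Or.inl (by omega))
      · exact single 1 (x 1) (ne.2 (by omega)) (Or.inl rfl) (Or.inr (Or.inl (by omega)))
      · exact single 1 ⟨n - 2, by simp only [Set.mem_Icc]; omega⟩ (ne.2 (by omega))
          (by unfold Near; dsimp only; omega) (Or.inr (Or.inl (by dsimp only; omega)))
      · exact both ⟨n, by simp only [Set.mem_Icc]; omega⟩
          (Fin.forall_fin_two.2 ⟨ne.2 (by omega), ne.2 (by omega)⟩)
          (Fin.forall_fin_two.2
            ⟨by unfold Near; dsimp only; omega, by unfold Near; dsimp only; omega⟩)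
          (Or.inr (Or.inr (Or.inl (by dsimp only; omega))))
      · exact both ⟨n - 2, by simp only [Set.mem_Icc]; omega⟩
          (Fin.forall_fin_two.2 ⟨ne.2 (by omega), ne.2 (by omega)⟩)
          (Fin.forall_fin_two.2
            ⟨by unfold Near; dsimp only; omega, by unfold Near; dsimp only; omega⟩)
          (Or.inr (Or.inr (Or.inl (by dsimp only; omega))))
      -- A retreat to `n - 8` lets the pair reunite only at difference 6; this is what the last
      -- alternative of `Evades` is for.
      · exact both ⟨n - 2, by simp only [Set.mem_Icc]; omega⟩
          (Fin.forall_fin_two.2 ⟨ne.2 (by omega), ne.2 (by omega)⟩)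
          (Fin.forall_fin_two.2
            ⟨by unfold Near; dsimp only; omega, by unfold Near; dsimp only; omega⟩)
          (Or.inr (Or.inr (Or.inr (Or.inr (Or.inr (by dsimp only; omega))))))
  · intro start
    obtain ⟨r, hr⟩ : ∃ r : Set.Icc 1 n, Evades n (n - 4) (start 0) r := by
      have hc := (start 0).2
      simp only [Set.mem_Icc] at hc
      have : (start 0 : ℕ) = 1 ∨ (start 0 : ℕ) = 2 ∨ (3 ≤ (start 0 : ℕ) ∧ (start 0 : ℕ) + 2 ≤ n) ∨
          n ≤ (start 0 : ℕ) + 1 := by omega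
      rcases this with h | h | h | h
      · exact ⟨⟨6, by simp only [Set.mem_Icc]; omega⟩,
          Or.inr (Or.inr (Or.inl (by dsimp only; omega)))⟩
      · exact ⟨⟨8, by simp only [Set.mem_Icc]; omega⟩,
          Or.inr (Or.inr (Or.inr (Or.inl (by dsimp only; omega))))⟩
      · exact ⟨⟨start 0 + 2, by simp only [Set.mem_Icc]; omega⟩, Or.inl (by dsimp only; omega)⟩
      · exact ⟨⟨start 0 - 2, by simp only [Set.mem_Icc]; omega⟩,
          Or.inr (Or.inl (by dsimp only; omega))⟩
    refine ⟨fun _ => r, Or.inr (Or.inr (Or.inl ⟨r, n - 4, fun j => ?_, by omega, hr, by omega⟩))⟩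
    exact (capture_eq_some (c := start) (r := fun _ : Fin 2 => some r) (j := j)).2
      ⟨rfl, ne.2 (evades_ne hr)⟩

end CopsRobbers

theorem mainTheorem4 (ℓ n : ℕ) (hℓ : 2 ≤ ℓ) (hn : n = 4 * ℓ + 2) :
    CopsRobbers.capt (CopsRobbers.H n) 1 2 = ((ℓ + 2 * (n - 4) : ℕ) : ℕ∞) :=
  CopsRobbers.capt_eq (CopsRobbers.exists_winsBy_H hℓ hn)
    fun _ ht σ => CopsRobbers.not_winsBy_H hℓ hn ht σ
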